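/- Let $\mathcal S\subseteq\{-1,0,1\}^2$ be a finite step set with transition probabilities $p_s\ge 0$, $\sum_{s\in\mathcal S}p_s=1$ (and $p_s=0$ for $s\notin\mathcal S$). Assume that the walk is non-degenerate, i.e. the list $p_{1,1},p_{1,0},p_{1,-1},p_{0,-1},p_{-1,-1},p_{-1,0},p_{-1,1},p_{0,1}$ does not contain three consecutive zeros, and that it has zero drift, i.e. $\sum_{(i,j)\in\mathcal S}i\,p_{i,j}=\sum_{(i,j)\in\mathcal S}j\,p_{i,j}=0$. For a function $h:\mathbb Z^2\to\mathbb R$ define $\triangle h:\mathbb Z^2\to\mathbb R$ by $$\triangle h(i,j)=\sum_{(u,v)\in\mathcal S}p_{u,v}\,h(i+u,j+v)-h(i,j)\qquad (i,j\ge 1),$$ and $\triangle h(i,j)=0$ at all other points (Dirichlet boundary conditions). For $n\ge 0$ let $\mathcal H_n$ be the real vector space of discrete $n$-polyharmonic functions in the quarter plane, that is, of all functions $h:\mathbb Z^2\to\mathbb R$ with $h(i,j)=0$ unless $i\ge 1$ and $j\ge 1$ (so $h$ vanishes on the axes and outside the quarter plane) and $\triangle^n h=0$; in particular $\mathcal H_0=\{0\}$.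 Lemma. For every $n\ge 0$: 1. every $h\in\mathcal H_n$ has a $\triangle$-preimage in $\mathcal H_{n+1}$, i.e. there is $g\in\mathcal H_{n+1}$ with $\triangle g=h$; 2. there is an isomorphism of real vector spaces $\mathcal H_n\cong(\mathcal H_1)^n$. -/

import Mathlib

/-- A homogeneous random walk on `ℤ × ℤ` with small steps, non-degenerate and with zero drift:
`S` is the step set and `p s` is the probability of moving from `x` to `x + s`. -/
structure SmallStepWalk where
  S : Finset (ℤ × ℤ)
  p : ℤ × ℤ → ℝ
  small_steps : S ⊆ Finset.Icc (-1) 1 ×ˢ Finset.Icc (-1) 1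
  p_nonneg : ∀ s, 0 ≤ p s
  p_eq_zero : ∀ s, s ∉ S → p s = 0
  p_sum : ∑ s ∈ S, p s = 1
  /-- The eight probabilities of the nonzero small steps, listed clockwise around the origin,
  contain no three consecutive zeros. -/
  nondegenerate : ¬ [0, 0, 0] <:+:
    [p (1, 1), p (1, 0), p (1, -1), p (0, -1), p (-1, -1), p (-1, 0), p (-1, 1), p (0, 1)]
  drift_fst : ∑ s ∈ S, (s.1 : ℝ) * p s = 0
  drift_snd : ∑ s ∈ S, (s.2 : ℝ) * p s = 0

namespace QuarterPlane

/-- The points of the quarter plane that do not lie on the coordinate axes. -/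
def interior : Set (ℤ × ℤ) := {z | 0 < z.1 ∧ 0 < z.2}

/-- Real functions on `ℤ × ℤ` satisfying the Dirichlet boundary conditions: they vanish on the
two axes and outside of the quarter plane. -/
def dirichlet : Submodule ℝ (ℤ × ℤ → ℝ) where
  carrier := {f | ∀ z, z ∉ interior → f z = 0}
  add_mem' := by
    intro f g hf hg z hz
    simp [hf z hz, hg z hz]
  zero_mem' := by
    intro z _
    rfl
  smul_mem' := by
    intro c f hf z hz
    simp [hf z hz]

open Classical in
/-- The discrete Laplacian `Δ f (z) = ∑ s, p s * f (z + s) - f z` of the walk at the points `z`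
of the open quarter plane; `Δ f` is again given Dirichlet boundary values. -/
noncomputable def laplacian (W : SmallStepWalk) : (ℤ × ℤ → ℝ) →ₗ[ℝ] (ℤ × ℤ → ℝ) where
  toFun f z := if z ∈ interior then ∑ s ∈ W.S, W.p s * f (z + s) - f z else 0
  map_add' := by
    intro f g
    funext z
    by_cases hz : z ∈ interior
    · simp only [hz, if_true, Pi.add_apply, mul_add, Finset.sum_add_distrib]
      ring
    · simp [hz]
  map_smul' := by
    intro c f
    funext z
    by_cases hz : z ∈ interior
    · simp only [hz, if_true, Pi.smul_apply, smul_eq_mul, RingHom.id_apply, mul_sub,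
        Finset.mul_sum]
      congr 1
      exact Finset.sum_congr rfl fun s _ => by ring
    · simp [hz]

/-- The space of real discrete `n`-polyharmonic functions in the quarter plane that vanish on the
axes: the solutions of `Δ ^ n h = 0` under the Dirichlet boundary conditions. -/
noncomputable def polyharmonic (W : SmallStepWalk) (n : ℕ) : Submodule ℝ (ℤ × ℤ → ℝ) :=
  dirichlet ⊓ LinearMap.ker (laplacian W ^ n)

end QuarterPlane

/-! Everything rests on surjectivity of the Laplacian on Dirichlet functions
(`exists_laplacian_eq`). By linear duality this follows from injectivity of its transpose on
finitely supported functions, which is a maximum principle: a maximum of |μ| over the interior would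
propagate along an infinite ray of reversed steps. The kernel of Δ on each `polyharmonic W (n + 1)`
is the harmonic space, so 0 → H₁ → Hₙ₊₁ → Hₙ → 0 is exact; it splits over a field, and induction
finishes. -/

namespace SmallStepWalk

/-- A non-degenerate walk makes some nonzero step with positive probability. -/
theorem exists_ne_zero_pos (W : SmallStepWalk) : ∃ s ∈ W.S, s ≠ 0 ∧ 0 < W.p s := by
  by_contra! hcon
  have hzero : ∀ s, s ≠ 0 → W.p s = 0 := fun s hs => by
    by_cases hS : s ∈ W.S
    · exact le_antisymm (hcon s hS hs) (W.p_nonneg s)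
    · exact W.p_eq_zero s hS
  apply W.nondegenerate
  rw [hzero (1, 1) (by decide), hzero (1, 0) (by decide), hzero (1, -1) (by decide)]
  exact (List.prefix_append [0, 0, 0] _).isInfix

end SmallStepWalk

/-- A function with finite support that is dominated by its average along the reversed steps
vanishes identically. -/
theorem SmallStepWalk.eq_zero_of_le_average (W : SmallStepWalk) (f : ℤ × ℤ → ℝ)
    (hf : f.support.Finite) (hnonneg : ∀ z, 0 ≤ f z)
    (hle : ∀ z, f z ≠ 0 → f z ≤ ∑ s ∈ W.S, W.p s * f (z - s)) : f = 0 := by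
  by_contra hne
  obtain ⟨z₁, hz₁⟩ := Function.ne_iff.mp hne
  obtain ⟨z₀, hz₀, hmax⟩ := hf.toFinset.exists_max_image f ⟨z₁, by simpa using hz₁⟩
  have hpos : 0 < f z₀ := lt_of_le_of_ne (hnonneg z₀) (Ne.symm (by simpa using hz₀))
  have hbound : ∀ z, f z ≤ f z₀ := fun z => by
    by_cases hz : f z = 0
    · exact hz ▸ hpos.le
    · exact hmax z (by simpa using hz)
  obtain ⟨s, hs, hs0, hps⟩ := W.exists_ne_zero_pos
  -- The weights sum to 1, so one strictly smaller value at a step of positive weight would pull the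
  -- average below the maximum.
  have hstep : ∀ z, f z = f z₀ → f (z - s) = f z₀ := fun z hz => by
    refine le_antisymm (hbound _) (not_lt.mp fun hlt => ?_)
    have hsum : ∑ t ∈ W.S, W.p t * f (z - t) < ∑ t ∈ W.S, W.p t * f z₀ :=
      Finset.sum_lt_sum (fun t _ => mul_le_mul_of_nonneg_left (hbound _) (W.p_nonneg t))
        ⟨s, hs, mul_lt_mul_of_pos_left hlt hps⟩
    rw [← Finset.sum_mul, W.p_sum, one_mul] at hsum
    exact absurd (hle z (hz ▸ hpos.ne')) (by rw [hz]; exact not_le.mpr hsum)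
  have hiter : ∀ n : ℕ, f (z₀ - n • s) = f z₀ := fun n => by
    induction n with
    | zero => simp
    | succ n ih => rw [succ_nsmul, ← sub_sub]; exact hstep _ ih
  have hinj : Function.Injective fun n : ℕ => z₀ - n • s := fun m n hmn => by
    have h : m • s = n • s := sub_right_injective hmn
    have h1 := congrArg Prod.fst h
    have h2 := congrArg Prod.snd h
    rw [Prod.smul_fst, Prod.smul_fst, nsmul_eq_mul, nsmul_eq_mul] at h1
    rw [Prod.smul_snd, Prod.smul_snd, nsmul_eq_mul, nsmul_eq_mul] at h2
    by_contra hne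
    have hmn' : (m : ℤ) ≠ n := by exact_mod_cast hne
    exact hs0 (Prod.ext (by simpa [hmn'] using h1) (by simpa [hmn'] using h2))
  exact Set.infinite_of_injective_forall_mem hinj
    (fun n => Function.mem_support.mpr (hiter n ▸ hpos.ne')) hf

namespace QuarterPlane

open Classical in
/-- The formal transpose of the Laplacian, acting on finitely supported functions: it sends the
point mass at an interior point `z` to `∑ s, p s • δ (z + s) - δ z`, and fixes the point masses
at the other points. -/
noncomputable def transposeLaplacian (W : SmallStepWalk) :
    (ℤ × ℤ →₀ ℝ) →ₗ[ℝ] (ℤ × ℤ →₀ ℝ) :=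
  Finsupp.linearCombination ℝ fun z =>
    if z ∈ interior then
      ∑ s ∈ W.S, W.p s • Finsupp.single (z + s) (1 : ℝ) - Finsupp.single z 1
    else Finsupp.single z 1

open Classical in
-- Mass reaches `w` only from interior points `w - s`; this is where the reversed steps of the
-- maximum principle come from.
theorem transposeLaplacian_apply (W : SmallStepWalk) (μ : ℤ × ℤ →₀ ℝ) (w : ℤ × ℤ) :
    transposeLaplacian W μ w =
      ∑ s ∈ W.S, W.p s * (if w - s ∈ interior then μ (w - s) else 0) +
        if w ∈ interior then -μ w else μ w := by
  induction μ using Finsupp.induction_linear with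
  | zero => simp
  | add μ ν hμ hν =>
    have hsplit : ∀ (P : Prop) (a b : ℝ), (if P then a + b else 0) =
        (if P then a else 0) + if P then b else 0 := by
      intro P a b; split_ifs <;> simp
    rw [map_add, Finsupp.add_apply, hμ, hν]
    simp only [Finsupp.add_apply, hsplit, mul_add, Finset.sum_add_distrib]
    split_ifs <;> ring
  | single z a =>
    rw [transposeLaplacian, Finsupp.linearCombination_single]
    have hterm : ∀ s, (if w - s ∈ interior then Finsupp.single z a (w - s) else 0) =
        if z ∈ interior then a * Finsupp.single (z + s) (1 : ℝ) w else 0 := fun s => by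
      by_cases h : z + s = w
      · subst h; simp
      · have h' : z ≠ w - s := fun h' => h (by rw [h', sub_add_cancel])
        simp [Finsupp.single_eq_of_ne' h, Finsupp.single_eq_of_ne' h']
    simp only [hterm]
    by_cases hz : z ∈ interior
    · simp only [hz, if_true, Finsupp.smul_apply, Finsupp.sub_apply, Finsupp.finsetSum_apply,
        smul_eq_mul, mul_sub, Finset.mul_sum]
      rw [sub_eq_add_neg]
      congr 1
      · exact Finset.sum_congr rfl fun s _ => by ring
      · by_cases h : z = w
        · subst h; simp [hz]
        · simp [Finsupp.single_eq_of_ne' h]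
    · by_cases h : z = w
      · subst h; simp [hz]
      · simp [hz, Finsupp.single_eq_of_ne' h]

theorem transposeLaplacian_injective (W : SmallStepWalk) :
    Function.Injective (transposeLaplacian W) := by
  classical
  rw [injective_iff_map_eq_zero]
  intro μ hμ
  have happ : ∀ w, ∑ s ∈ W.S, W.p s * (if w - s ∈ interior then μ (w - s) else 0) +
      (if w ∈ interior then -μ w else μ w) = 0 := fun w => by
    rw [← transposeLaplacian_apply, hμ, Finsupp.zero_apply]
  -- At interior points the kernel equation makes μ an average of its interior values along reversed
  -- steps; the triangle inequality passes this to |μ|.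
  have hzero : (fun z => |if z ∈ interior then μ z else 0|) = 0 := by
    refine W.eq_zero_of_le_average _ (μ.support.finite_toSet.subset fun z hz => ?_)
      (fun z => abs_nonneg _) fun z hz => ?_
    · by_contra h
      simp_all
    · have hzi : z ∈ interior := by
        by_contra h
        simp [h] at hz
      have hμz := happ z
      simp only [hzi, if_true] at hμz ⊢
      rw [show μ z = _ from (add_neg_eq_zero.mp hμz).symm]
      refine (Finset.abs_sum_le_sum_abs _ _).trans (Finset.sum_le_sum fun s _ => ?_)
      rw [abs_mul, abs_of_nonneg (W.p_nonneg s)]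
  have hint : ∀ z, (if z ∈ interior then μ z else 0) = 0 := fun z =>
    abs_eq_zero.mp (congrFun hzero z)
  ext z
  have hμz := happ z
  -- With no interior mass left, the transpose acts as the identity, so the exterior values vanish
  -- too.
  simp only [hint, mul_zero, Finset.sum_const_zero, zero_add] at hμz
  split_ifs at hμz
  · exact neg_eq_zero.mp hμz
  · exact hμz

theorem laplacian_mem_dirichlet (W : SmallStepWalk) (f : ℤ × ℤ → ℝ) :
    laplacian W f ∈ dirichlet := fun z hz => by simp [laplacian, hz]

/-- The Laplacian maps the functions with Dirichlet boundary values onto themselves. -/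
theorem exists_laplacian_eq (W : SmallStepWalk) {h : ℤ × ℤ → ℝ} (hh : h ∈ dirichlet) :
    ∃ g ∈ dirichlet, laplacian W g = h := by
  -- A function on the lattice is a linear functional on finitely supported functions. Extending `h`
  -- through a left inverse gives ψ with ψ ∘ Δᵗ = `h`; its values on point masses are the preimage.
  obtain ⟨B, hB⟩ := (transposeLaplacian W).exists_leftInverse_of_injective
    (LinearMap.ker_eq_bot.mpr (transposeLaplacian_injective W))
  let ψ : (ℤ × ℤ →₀ ℝ) →ₗ[ℝ] ℝ := Finsupp.linearCombination ℝ h ∘ₗ B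
  have hψ : ∀ z, ψ (transposeLaplacian W (Finsupp.single z 1)) = h z := fun z => by
    have hBz : B (transposeLaplacian W (Finsupp.single z 1)) = Finsupp.single z 1 :=
      LinearMap.congr_fun hB _
    simp [ψ, hBz]
  refine ⟨fun z => ψ (Finsupp.single z 1), fun z hz => ?_, funext fun z => ?_⟩
  -- The transpose fixes exterior point masses, which forces the Dirichlet condition on the
  -- preimage.
  · have := hψ z
    rw [transposeLaplacian, Finsupp.linearCombination_single, one_smul, if_neg hz] at this
    exact this.trans (hh z hz)
  · by_cases hz : z ∈ interior
    · have := hψ z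
      rw [transposeLaplacian, Finsupp.linearCombination_single, one_smul, if_pos hz] at this
      rw [← this]
      simp only [laplacian, LinearMap.coe_mk, AddHom.coe_mk, if_pos hz, map_sub, map_sum,
        map_smul, smul_eq_mul]
    · rw [laplacian_mem_dirichlet W _ z hz, hh z hz]

theorem mem_polyharmonic (W : SmallStepWalk) (n : ℕ) (h : ℤ × ℤ → ℝ) :
    h ∈ polyharmonic W n ↔ h ∈ dirichlet ∧ (laplacian W ^ n) h = 0 := Iff.rfl

theorem mem_polyharmonic_succ (W : SmallStepWalk) (n : ℕ) (h : ℤ × ℤ → ℝ) :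
    h ∈ polyharmonic W (n + 1) ↔ h ∈ dirichlet ∧ laplacian W h ∈ polyharmonic W n := by
  simp only [mem_polyharmonic, pow_succ, Module.End.mul_apply, laplacian_mem_dirichlet, true_and]

theorem mem_polyharmonic_zero (W : SmallStepWalk) (h : ℤ × ℤ → ℝ) :
    h ∈ polyharmonic W 0 ↔ h = 0 := by
  rw [mem_polyharmonic, pow_zero, Module.End.one_apply]
  exact ⟨And.right, fun h0 => ⟨h0 ▸ dirichlet.zero_mem, h0⟩⟩

theorem exists_polyharmonic_laplacian_eq (W : SmallStepWalk) (n : ℕ) {h : ℤ × ℤ → ℝ}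
    (hh : h ∈ polyharmonic W n) : ∃ g ∈ polyharmonic W (n + 1), laplacian W g = h := by
  obtain ⟨g, hg, rfl⟩ := exists_laplacian_eq W hh.1
  exact ⟨g, (mem_polyharmonic_succ W n g).mpr ⟨hg, hh⟩, rfl⟩

/-- The Laplacian as a map from `(n + 1)`-polyharmonic to `n`-polyharmonic functions. -/
noncomputable def laplacianRestrict (W : SmallStepWalk) (n : ℕ) :
    polyharmonic W (n + 1) →ₗ[ℝ] polyharmonic W n :=
  (laplacian W).restrict fun h hh => ((mem_polyharmonic_succ W n h).mp hh).2

theorem laplacianRestrict_surjective (W : SmallStepWalk) (n : ℕ) :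
    Function.Surjective (laplacianRestrict W n) := fun h => by
  obtain ⟨g, hg, hgh⟩ := exists_polyharmonic_laplacian_eq W n h.2
  exact ⟨⟨g, hg⟩, Subtype.ext hgh⟩

theorem mem_polyharmonic_one (W : SmallStepWalk) (h : ℤ × ℤ → ℝ) :
    h ∈ polyharmonic W 1 ↔ h ∈ dirichlet ∧ laplacian W h = 0 := by
  rw [mem_polyharmonic, pow_one]

/-- The kernel of the Laplacian on polyharmonic functions is the space of harmonic functions. -/
noncomputable def kerLaplacianRestrictEquiv (W : SmallStepWalk) (n : ℕ) :
    LinearMap.ker (laplacianRestrict W n) ≃ₗ[ℝ] polyharmonic W 1 where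
  toFun h := ⟨h.1.1, (mem_polyharmonic_one W _).mpr
    ⟨h.1.2.1, congrArg Subtype.val (LinearMap.mem_ker.mp h.2)⟩⟩
  map_add' _ _ := rfl
  map_smul' _ _ := rfl
  invFun h := ⟨⟨h.1, (mem_polyharmonic_succ W n _).mpr ⟨h.2.1, by
      rw [((mem_polyharmonic_one W _).mp h.2).2]
      exact zero_mem _⟩⟩,
    LinearMap.mem_ker.mpr (Subtype.ext ((mem_polyharmonic_one W _).mp h.2).2)⟩
  left_inv _ := rfl
  right_inv _ := rfl

/-- A complement of the kernel is carried isomorphically onto Hₙ by the surjective restricted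
Laplacian. -/
theorem nonempty_polyharmonic_succ_equiv (W : SmallStepWalk) (n : ℕ) :
    Nonempty (polyharmonic W (n + 1) ≃ₗ[ℝ] polyharmonic W 1 × polyharmonic W n) := by
  obtain ⟨Q, hQ⟩ := (LinearMap.ker (laplacianRestrict W n)).exists_isCompl
  exact ⟨(Submodule.prodEquivOfIsCompl _ Q hQ).symm ≪≫ₗ
    (kerLaplacianRestrictEquiv W n).prodCongr
      ((Submodule.quotientEquivOfIsCompl _ Q hQ).symm ≪≫ₗ
        (laplacianRestrict W n).quotKerEquivOfSurjective (laplacianRestrict_surjective W n))⟩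

theorem nonempty_polyharmonic_equiv (W : SmallStepWalk) (n : ℕ) :
    Nonempty (polyharmonic W n ≃ₗ[ℝ] (Fin n → polyharmonic W 1)) := by
  induction n with
  | zero =>
    have : Subsingleton (polyharmonic W 0) := ⟨fun a b => Subtype.ext <| by
      rw [(mem_polyharmonic_zero W _).mp a.2, (mem_polyharmonic_zero W _).mp b.2]⟩
    exact ⟨LinearEquiv.ofSubsingleton _ _⟩
  | succ n ih =>
    obtain ⟨e⟩ := ih
    obtain ⟨e'⟩ := nonempty_polyharmonic_succ_equiv W n
    exact ⟨e' ≪≫ₗ (LinearEquiv.refl ℝ _).prodCongr e ≪≫ₗ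
      Fin.consLinearEquiv ℝ fun _ => polyharmonic W 1⟩

end QuarterPlane

theorem mainTheorem7 (W : SmallStepWalk) :
    (∀ n : ℕ, ∀ h ∈ QuarterPlane.polyharmonic W n,
      ∃ g ∈ QuarterPlane.polyharmonic W (n + 1), QuarterPlane.laplacian W g = h) ∧
    ∀ n : ℕ, Nonempty
      (QuarterPlane.polyharmonic W n ≃ₗ[ℝ] (Fin n → QuarterPlane.polyharmonic W 1)) :=
  ⟨fun n _ hh => QuarterPlane.exists_polyharmonic_laplacian_eq W n hh,
    QuarterPlane.nonempty_polyharmonic_equiv W⟩
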